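/- Let $\mathcal G$ be a weighted directed graph on $\{1,\dots,n\}$, $n\ge 1$, without self-loops: each edge $(j,i)$ (node $i$ receives from node $j$) has a weight $a_{ij}>0$, and $a_{ij}=0$ for non-edges. Let $\mathcal N_i=\{j:(j,i)\text{ is an edge}\}$, $d_i=\sum_{j\in\mathcal N_i}a_{ij}$, and let $L=\operatorname{diag}(d_1,\dots,d_n)-[a_{ij}]$ be the Laplacian. Assume (Assumption 1) $\mathcal G$ is strongly connected. Let $\omega\in\mathbb R^n$ be the left eigenvector with $\omega^TL=0$ and $\sum_i\omega_i=1$, let $\alpha>0$ satisfy $\alpha d_i<1$ for all $i$, let $\Delta>0$, and let $z_{ii}(0)=1$, $z_{ij}(0)=0$ for $j\ne i$, and $$z_{ij}(t+1)=z_{ij}(t)+\alpha\sum_{k\in\mathcal N_i}a_{ik}\bigl[\mathcal Q_{t,k,j}(z_{kj}(t))-\mathcal Q_{t,i,j}(z_{ij}(t))\bigr],\qquad t\ge 0.$$ Here $\mathcal Q_{t,i,j}$ is the random quantizer which node $i$ applies at time $t$ to the $j$-th entry of its vector. Each $\mathcal Q_{t,i,j}$ is either the probabilistic quantizer with step $\Delta$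 (for every $x\in\mathbb R$, $\mathcal Q_{t,i,j}(x)=\lceil x/\Delta\rceil\Delta$ with probability $p=x/\Delta-\lfloor x/\Delta\rfloor$ and $\lfloor x/\Delta\rfloor\Delta$ with probability $1-p$), or a dithered quantizer $\mathcal Q_{t,i,j}(x)=x+u_{t,i,j}$, whose error $u_{t,i,j}$ does not depend on the input $x$, has mean zero and satisfies $|u_{t,i,j}|\le\Delta$ almost surely. Assume (Assumption 2) the quantization errors are independent of the data and temporally and spatially independent: there are mutually independent $\sigma$-algebras $\mathscr G_{t,i}$ (over all times $t$ and nodes $i$) such that the error functions $x\mapsto\mathcal Q_{t,i,j}(x)-x$, $1\le j\le n$, are measurable in $x$ and $\mathscr G_{t,i}$ jointly. For $k_0\ge 0$ and $K\ge 1$ let $\bar z_{ij}(K)=\frac1K\sum_{k=k_0+1}^{k_0+K}z_{ij}(k)$. Then $\omega_i>0$ for all $i$, and for every $0<\eta<1$ there is a (random, integer-valued, almost surely finite) time $t_\eta$ such that, almost surely, $$\min_i\frac{\bar z_{ii}(t)}{\omega_i}\ \ge\ \eta\qquad\text{for all } t\ge t_\eta .$$ In particular, almost surely, $\bar z_{ii}(t)>0$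 for all $i$ and all $t\ge t_\eta$, so that for these $t$ the correction terms $\epsilon_i(t)=y_i\bigl[\frac1{n\bar z_{ii}(t+1)}-\frac1{n\bar z_{ii}(t)}\bigr]$, and the initial one $y_i\bigl[\frac1{n\bar z_{ii}(t+1)}-1\bigr]$, which have $\bar z_{ii}$ in their denominators, are well defined. -/

import Mathlib

open MeasureTheory ProbabilityTheory

namespace QuantizedConsensus

/-- A weighted directed graph on the nodes `Fin n`, without self-loops. `G.Adj j i` is the directed
edge `(j, i)` (node `i` receives data from node `j`), which carries the weight `G.weight i j > 0`;
the other entries of the weight matrix vanish. -/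
structure WeightedDigraph (n : ℕ) extends Digraph (Fin n) where
  weight : Matrix (Fin n) (Fin n) ℝ
  weight_pos : ∀ i j, Adj j i → 0 < weight i j
  weight_eq_zero : ∀ i j, ¬ Adj j i → weight i j = 0
  no_loop : ∀ i, ¬ Adj i i

namespace WeightedDigraph

variable {n : ℕ}

/-- For any two nodes `i`, `j` there is a directed path from `i` to `j`. -/
def StronglyConnected (G : WeightedDigraph n) : Prop :=
  ∀ i j : Fin n, Relation.ReflTransGen G.Adj i j

open Classical in
/-- The nodes from which node `i` receives data. -/
noncomputable def neighbors (G : WeightedDigraph n) (i : Fin n) : Finset (Fin n) :=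
  Finset.univ.filter fun j => G.Adj j i

/-- The weighted in-degree `d_i`. -/
noncomputable def inDegree (G : WeightedDigraph n) (i : Fin n) : ℝ :=
  ∑ j ∈ G.neighbors i, G.weight i j

/-- The Laplacian `L = D - A`. -/
noncomputable def laplacian (G : WeightedDigraph n) : Matrix (Fin n) (Fin n) ℝ :=
  Matrix.diagonal G.inDegree - G.weight

end WeightedDigraph

section Quantization

variable {Ω : Type*} [MeasurableSpace Ω]

/-- `Q x` is the random quantized value of the input `x`. Probabilistic quantization with step `Δ`:
for every `x`, the value is `⌈x/Δ⌉ Δ` with probability `p = x/Δ - ⌊x/Δ⌋` and `⌊x/Δ⌋ Δ` with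
probability `1 - p`. -/
def IsProbabilisticQuantizer (μ : Measure Ω) (Δ : ℝ) (Q : ℝ → Ω → ℝ) : Prop :=
  ∀ x : ℝ, μ.map (Q x) =
    ENNReal.ofReal (x / Δ - ⌊x / Δ⌋) • Measure.dirac ((⌈x / Δ⌉ : ℝ) * Δ) +
    ENNReal.ofReal (1 - (x / Δ - ⌊x / Δ⌋)) • Measure.dirac ((⌊x / Δ⌋ : ℝ) * Δ)

/-- The additive (subtractively dithered) form of quantization: `Q x = x + u`, where the error `u`
does not depend on the input, has mean zero, and is bounded by the step `Δ`. -/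
def IsDitheredQuantizer (μ : Measure Ω) (Δ : ℝ) (Q : ℝ → Ω → ℝ) : Prop :=
  ∃ u : Ω → ℝ, (∀ x ω, Q x ω = x + u ω) ∧ (∀ᵐ ω ∂μ, |u ω| ≤ Δ) ∧ Integrable u μ ∧
    ∫ ω, u ω ∂μ = 0

/-- Temporal and spatial independence of the quantization errors. `Q t i j` is the quantizer which
node `i` applies at time `t` to the `j`-th entry of its vector. The error vectors
`x ↦ (Q t i j x - x)_j`, as random functions of the input, are driven by sources of randomness
`𝓖 (t, i)` that are mutually independent over the times `t` and the nodes `i`. (The entries `j` at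
one node and one time may depend on each other.) A state that is computed from the quantizers used
before time `t` is therefore independent of the sources `𝓖 (t, i)`. -/
def ErrorsIndependent {n : ℕ} (μ : Measure Ω) (Q : ℕ → Fin n → Fin n → ℝ → Ω → ℝ) : Prop :=
  ∃ 𝓖 : ℕ × Fin n → MeasurableSpace Ω,
    (∀ p, 𝓖 p ≤ ‹MeasurableSpace Ω›) ∧ iIndep 𝓖 μ ∧
    ∀ t i j, Measurable[MeasurableSpace.prod (borel ℝ) (𝓖 (t, i))]
      fun p : ℝ × Ω => Q t i j p.1 p.2 - p.1

end Quantization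

section Algorithm

variable {Ω : Type*} {n : ℕ}

/-- The state `z_{ij}(t)`: `z_{ii}(0) = 1`, `z_{ij}(0) = 0` for `j ≠ i`, and
`z_i(t+1) = z_i(t) + α ∑_{k ∈ N_i} a_{ik} [Q(z_k(t)) - Q(z_i(t))]`, entry by entry. -/
noncomputable def state (G : WeightedDigraph n) (α : ℝ) (Q : ℕ → Fin n → Fin n → ℝ → Ω → ℝ) :
    ℕ → Fin n → Fin n → Ω → ℝ
  | 0 => fun i j _ => if i = j then 1 else 0
  | t + 1 => fun i j ω => state G α Q t i j ω +
      α * ∑ k ∈ G.neighbors i, G.weight i k *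
        (Q t k j (state G α Q t k j ω) ω - Q t i j (state G α Q t i j ω) ω)

/-- The running average `(1/K) ∑_{k = k₀+1}^{k₀+K} z_{ij}(k)`, for `K ≥ 1`. -/
noncomputable def runningAverage (G : WeightedDigraph n) (α : ℝ)
    (Q : ℕ → Fin n → Fin n → ℝ → Ω → ℝ) (k₀ K : ℕ) (i j : Fin n) (ω : Ω) : ℝ :=
  (1 / (K : ℝ)) * ∑ k ∈ Finset.Icc (k₀ + 1) (k₀ + K), state G α Q k i j ω

end Algorithm

end QuantizedConsensus

/-! With `W = I - α L`, each column of the state obeys `x(t+1) = W x(t) - (I - W) e(t)`, `e` the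
quantization errors. `W` is stochastic and, by strong connectivity and its positive diagonal,
primitive; hence `w > 0`. Since `w W = w`, the value `w ⬝ᵥ x` is conserved, equal to `w j` for
column `j`.

The deviation `y = x - (w j) 1` is annihilated by `w`, where a power `W ^ N` contracts; bounded
errors thus keep `y` bounded. Summing the recursion telescopes: `(I - W)` applied to the average of
`y` is a boundary term of order `1/m` minus `(I - W)` applied to the average of `e`. The contraction
makes `I - W` boundedly invertible on this subspace, so averages of `y` vanish if those of `e` do
(`tendsto_average_of_recursion`).

The latter is a strong law: given the past, an error has mean zero and size at most `Δ`, so errors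
at different times are orthogonal (`ae_tendsto_average_of_orthogonal`). Thus every diagonal average
divided by `w i` tends to `1 > η`. -/

namespace QuantizedConsensus

open Filter Topology Matrix

/-! ### Primitive stochastic matrices and averages of perturbed recursions -/

section StochasticMatrix

variable {ι : Type*} [Fintype ι]

theorem pow_nonneg_entry [DecidableEq ι] {W : Matrix ι ι ℝ} (h0 : ∀ i j, 0 ≤ W i j) (m : ℕ) (i j : ι) :
    0 ≤ (W ^ m) i j := by
  induction m generalizing i j with
  | zero =>
    rw [pow_zero, Matrix.one_apply]
    split_ifs <;> norm_num
  | succ m ih =>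
    rw [pow_succ, Matrix.mul_apply]
    exact Finset.sum_nonneg fun k _ => mul_nonneg (ih i k) (h0 k j)

theorem pow_succ_entry_pos [DecidableEq ι] {W : Matrix ι ι ℝ} (h0 : ∀ i j, 0 ≤ W i j) {m : ℕ} {i j k : ι}
    (h : 0 < (W ^ m) j k) (hij : 0 < W i j) : 0 < (W ^ (m + 1)) i k := by
  rw [pow_succ', Matrix.mul_apply]
  exact Finset.sum_pos' (fun l _ => mul_nonneg (h0 i l) (pow_nonneg_entry h0 m l k))
    ⟨j, Finset.mem_univ _, mul_pos hij h⟩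

theorem pow_entry_pos_of_le [DecidableEq ι] {W : Matrix ι ι ℝ} (h0 : ∀ i j, 0 ≤ W i j) (hd : ∀ i, 0 < W i i)
    {m l : ℕ} (hml : m ≤ l) {i j : ι} (h : 0 < (W ^ m) i j) : 0 < (W ^ l) i j := by
  induction l, hml using Nat.le_induction with
  | base => exact h
  | succ l _ ih => exact pow_succ_entry_pos h0 ih (hd i)

/-- A nonnegative matrix with positive diagonal and strongly connected support is primitive. -/
theorem exists_pow_pos [DecidableEq ι] {W : Matrix ι ι ℝ} (h0 : ∀ i j, 0 ≤ W i j) (hd : ∀ i, 0 < W i i)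
    {r : ι → ι → Prop} (hr : ∀ i j, r j i → 0 < W i j)
    (hconn : ∀ i j, Relation.ReflTransGen r i j) : ∃ N, ∀ i j, 0 < (W ^ N) i j := by
  have key : ∀ i j, ∃ m, 0 < (W ^ m) j i := by
    intro i j
    induction hconn i j with
    | refl => exact ⟨0, by simp⟩
    | tail _ hbc ih =>
      obtain ⟨m, hm⟩ := ih
      exact ⟨m + 1, pow_succ_entry_pos h0 hm (hr _ _ hbc)⟩
  choose m hm using key
  -- The sum dominates every path length, and the positive diagonal lets any path be prolonged by
  -- waiting.
  refine ⟨∑ p : ι × ι, m p.1 p.2, fun i j => pow_entry_pos_of_le h0 hd ?_ (hm j i)⟩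
  exact Finset.single_le_sum (f := fun p : ι × ι => m p.1 p.2) (fun _ _ => Nat.zero_le _)
    (Finset.mem_univ (j, i))

theorem pow_mulVec_one [DecidableEq ι] {W : Matrix ι ι ℝ} (h1 : W *ᵥ 1 = 1) (m : ℕ) : (W ^ m) *ᵥ 1 = 1 := by
  induction m with
  | zero => simp
  | succ m ih => rw [pow_succ, ← Matrix.mulVec_mulVec, h1, ih]

theorem vecMul_pow [DecidableEq ι] {W : Matrix ι ι ℝ} {w : ι → ℝ} (h : w ᵥ* W = w) (m : ℕ) :
    w ᵥ* (W ^ m) = w := by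
  induction m with
  | zero => simp
  | succ m ih => rw [pow_succ, ← Matrix.vecMul_vecMul, ih, h]

/-- A left fixed vector of positive total mass of an entrywise positive stochastic matrix is
positive. -/
theorem pos_of_vecMul_eq {P : Matrix ι ι ℝ} (hP : ∀ i j, 0 < P i j) (h1 : P *ᵥ 1 = 1)
    {w : ι → ℝ} (hw : w ᵥ* P = w) (hs : ∑ i, w i = 1) (i : ι) : 0 < w i := by
  have hrow : ∀ k, ∑ j, P k j = 1 := fun k => by
    simpa [Matrix.mulVec, dotProduct] using congrFun h1 k
  have hcol : ∀ j, ∑ k, w k * P k j = w j := fun j => congrFun hw j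
  -- The positive part of `w` is subinvariant; unit row sums give both sides the same total, so it
  -- is invariant. Being nonzero, it is positive everywhere.
  have hle : ∀ j, max (w j) 0 ≤ ∑ k, max (w k) 0 * P k j := by
    intro j
    refine max_le ?_ (Finset.sum_nonneg fun k _ => mul_nonneg (le_max_right _ _) (hP k j).le)
    rw [← hcol j]
    exact Finset.sum_le_sum fun k _ => mul_le_mul_of_nonneg_right (le_max_left _ _) (hP k j).le
  have hsum : ∑ j, max (w j) 0 = ∑ j, ∑ k, max (w k) 0 * P k j := by
    rw [Finset.sum_comm]
    simp_rw [← Finset.mul_sum, hrow, mul_one]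
  have heq := (Finset.sum_eq_sum_iff_of_le fun j _ => hle j).1 hsum i (Finset.mem_univ i)
  obtain ⟨k, -, hk⟩ : ∃ k ∈ Finset.univ, 0 < w k := by
    refine Finset.exists_lt_of_sum_lt (s := Finset.univ) (f := fun _ => (0 : ℝ)) ?_
    simp [hs]
  have : 0 < max (w i) 0 := by
    rw [heq]
    exact Finset.sum_pos' (fun l _ => mul_nonneg (le_max_right _ _) (hP l i).le)
      ⟨k, Finset.mem_univ _, mul_pos (lt_max_of_lt_left hk) (hP k i)⟩
  simpa using this

theorem norm_mulVec_le {W : Matrix ι ι ℝ} (h0 : ∀ i j, 0 ≤ W i j) (h1 : W *ᵥ 1 = 1)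
    (y : ι → ℝ) : ‖W *ᵥ y‖ ≤ ‖y‖ := by
  have hrow : ∀ k, ∑ j, W k j = 1 := fun k => by
    simpa [Matrix.mulVec, dotProduct] using congrFun h1 k
  refine (pi_norm_le_iff_of_nonneg (norm_nonneg _)).2 fun i => ?_
  calc ‖∑ j, W i j * y j‖ ≤ ∑ j, W i j * ‖y‖ := by
        refine norm_sum_le_of_le _ fun j _ => ?_
        rw [norm_mul, Real.norm_of_nonneg (h0 i j)]
        exact mul_le_mul_of_nonneg_left (norm_le_pi_norm y j) (h0 i j)
    _ = ‖y‖ := by rw [← Finset.sum_mul, hrow, one_mul]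

/-- An entrywise positive stochastic matrix contracts the annihilator of its invariant
distribution in the supremum norm. -/
theorem norm_mulVec_le_of_dotProduct_eq_zero {P : Matrix ι ι ℝ} {δ : ℝ}
    (h1 : P *ᵥ 1 = 1) {w : ι → ℝ} (hδ : ∀ i j, δ * w j ≤ P i j) (hs : ∑ i, w i = 1)
    {y : ι → ℝ} (hy : w ⬝ᵥ y = 0) : ‖P *ᵥ y‖ ≤ (1 - δ) * ‖y‖ := by
  have hrow : ∀ k, ∑ j, P k j = 1 := fun k => by
    simpa [Matrix.mulVec, dotProduct] using congrFun h1 k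
  have hδ' : ∀ i, ∑ j, (P i j - δ * w j) = 1 - δ := fun i => by
    rw [Finset.sum_sub_distrib, hrow, ← Finset.mul_sum, hs, mul_one]
  rcases isEmpty_or_nonempty ι with _ | ⟨⟨i₀⟩⟩
  · simp at hs
  have h1δ : 0 ≤ 1 - δ := hδ' i₀ ▸ Finset.sum_nonneg fun j _ => sub_nonneg.2 (hδ i₀ j)
  refine (pi_norm_le_iff_of_nonneg (mul_nonneg h1δ (norm_nonneg _))).2 fun i => ?_
  -- Subtracting `δ w` from each row does not change the product, as `w ⬝ᵥ y = 0`, and leaves a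
  -- nonnegative row of mass `1 - δ`.
  have : (P *ᵥ y) i = ∑ j, (P i j - δ * w j) * y j := by
    have hy' : ∑ j, w j * y j = 0 := hy
    simp_rw [sub_mul, Finset.sum_sub_distrib, mul_assoc, ← Finset.mul_sum, hy']
    simp [Matrix.mulVec, dotProduct]
  rw [this, ← hδ' i, Finset.sum_mul]
  refine norm_sum_le_of_le _ fun j _ => ?_
  rw [norm_mul, Real.norm_of_nonneg (sub_nonneg.2 (hδ i j))]
  exact mul_le_mul_of_nonneg_left (norm_le_pi_norm y j) (sub_nonneg.2 (hδ i j))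

/-- Each step adds one input, and `W` does not expand the inputs already accumulated. -/
theorem norm_sub_pow_mulVec_le [DecidableEq ι] {W : Matrix ι ι ℝ} (h0 : ∀ i j, 0 ≤ W i j) (h1 : W *ᵥ 1 = 1)
    {y v : ℕ → ι → ℝ} {C : ℝ} (hv : ∀ t, ‖v t‖ ≤ C) (hy : ∀ t, y (t + 1) = W *ᵥ y t + v t)
    (t s : ℕ) : ‖y (t + s) - (W ^ s) *ᵥ y t‖ ≤ s * C := by
  induction s with
  | zero => simp
  | succ s ih =>
    have : y (t + (s + 1)) - (W ^ (s + 1)) *ᵥ y t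
        = W *ᵥ (y (t + s) - (W ^ s) *ᵥ y t) + v (t + s) := by
      rw [← add_assoc, hy, pow_succ', ← Matrix.mulVec_mulVec, Matrix.mulVec_sub]
      abel
    rw [this]
    push_cast
    linarith [norm_add_le (W *ᵥ (y (t + s) - (W ^ s) *ᵥ y t)) (v (t + s)), hv (t + s),
      norm_mulVec_le h0 h1 (y (t + s) - (W ^ s) *ᵥ y t)]

/-- A stochastic recursion with bounded inputs stays bounded on a subspace which some power of
the matrix contracts. -/
theorem bounded_of_recursion [DecidableEq ι] {W : Matrix ι ι ℝ} (h0 : ∀ i j, 0 ≤ W i j) (h1 : W *ᵥ 1 = 1)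
    {y v : ℕ → ι → ℝ} {C δ : ℝ} {N : ℕ} (hδ : 0 < δ) (hδ1 : δ ≤ 1)
    (hv : ∀ t, ‖v t‖ ≤ C) (hy : ∀ t, y (t + 1) = W *ᵥ y t + v t)
    (hc : ∀ t, ‖(W ^ N) *ᵥ y t‖ ≤ (1 - δ) * ‖y t‖) :
    ∀ t, ‖y t‖ ≤ ‖y 0‖ + N * C / δ := by
  have hC : 0 ≤ C := (norm_nonneg _).trans (hv 0)
  have hNC : 0 ≤ (N : ℝ) * C := by positivity
  have hNCδ : (N : ℝ) * C ≤ N * C / δ := le_div_self hNC hδ hδ1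
  intro t
  induction t using Nat.strong_induction_on with
  | _ t ih =>
    rcases lt_or_ge t N with htN | htN
    · have h := norm_sub_pow_mulVec_le h0 h1 hv hy 0 t
      have h2 := norm_mulVec_le (pow_nonneg_entry h0 t) (pow_mulVec_one h1 t) (y 0)
      rw [zero_add] at h
      have h3 : (t : ℝ) * C ≤ N * C := by gcongr
      have h4 := norm_le_norm_add_norm_sub' (y t) ((W ^ t) *ᵥ y 0)
      linarith
    · rcases Nat.eq_zero_or_pos N with rfl | hN
      · have := hc t
        simp only [pow_zero, Matrix.one_mulVec] at this
        have h5 : ‖y t‖ ≤ 0 := by nlinarith [norm_nonneg (y t)]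
        have := norm_nonneg (y 0)
        simp only [CharP.cast_eq_zero, zero_mul, zero_div, add_zero]
        linarith
      -- Compare with time `t - N`: the bound `B = ‖y 0‖ + N C / δ` is preserved because `(1 - δ) B
      -- + N C ≤ B`.
      · obtain ⟨s, rfl⟩ := Nat.exists_eq_add_of_le' htN
        have h := norm_sub_pow_mulVec_le h0 h1 hv hy s N
        have h4 := norm_le_norm_add_norm_sub' (y (s + N)) ((W ^ N) *ᵥ y s)
        have h5 := mul_le_mul_of_nonneg_left (ih s (by omega)) (sub_nonneg.2 hδ1)
        have h6 : δ * (N * C / δ) = N * C := mul_div_cancel₀ _ hδ.ne'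
        have h7 := mul_nonneg hδ.le (norm_nonneg (y 0))
        linarith [hc s]

/-- A constant sequence solves the recursion with constant input `y - W y`. -/
theorem norm_sub_pow_mulVec_le_mul [DecidableEq ι] {W : Matrix ι ι ℝ} (h0 : ∀ i j, 0 ≤ W i j)
    (h1 : W *ᵥ 1 = 1) (y : ι → ℝ) (m : ℕ) : ‖y - (W ^ m) *ᵥ y‖ ≤ m * ‖y - W *ᵥ y‖ := by
  have := norm_sub_pow_mulVec_le h0 h1 (y := fun _ => y) (v := fun _ => y - W *ᵥ y)
    (fun _ => le_rfl) (fun _ => by abel) 0 m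
  exact this

/-- The time averages of a stochastic recursion with bounded inputs `(1 - W) e`, where the time
averages of `e` vanish in the limit, converge to the conserved weighted mean. -/
theorem tendsto_average_of_recursion [DecidableEq ι] {W : Matrix ι ι ℝ} (h0 : ∀ i j, 0 ≤ W i j)
    (h1 : W *ᵥ 1 = 1) {N : ℕ} (hN : ∀ i j, 0 < (W ^ N) i j) {w : ι → ℝ} (hw : w ᵥ* W = w)
    (hs : ∑ i, w i = 1) {x e : ℕ → ι → ℝ} {C : ℝ} (he : ∀ t, ‖e t‖ ≤ C)
    (hx : ∀ t, x (t + 1) = W *ᵥ x t - (e t - W *ᵥ e t))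
    (hlim : ∀ i, Tendsto (fun m : ℕ => (1 / (m : ℝ)) * ∑ s ∈ Finset.range m, e s i) atTop (𝓝 0))
    (i : ι) :
    Tendsto (fun m : ℕ => (1 / (m : ℝ)) * ∑ s ∈ Finset.range m, x s i) atTop
      (𝓝 (w ⬝ᵥ x 0)) := by
  have hw0 := pos_of_vecMul_eq hN (pow_mulVec_one h1 N) (vecMul_pow hw N) hs
  have hw1 : ∀ j, w j ≤ 1 := fun j =>
    hs ▸ Finset.single_le_sum (fun k _ => (hw0 k).le) (Finset.mem_univ j)
  obtain ⟨δ, hδ, hδ1, hδP⟩ : ∃ δ : ℝ, 0 < δ ∧ δ ≤ 1 ∧ ∀ i j, δ * w j ≤ (W ^ N) i j := by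
    have : Nonempty (ι × ι) := ⟨(i, i)⟩
    obtain ⟨p, hp⟩ := Finite.exists_min fun p : ι × ι => (W ^ N) p.1 p.2
    refine ⟨min ((W ^ N) p.1 p.2) 1, lt_min (hN _ _) one_pos, min_le_right _ _, fun k l => ?_⟩
    calc _ ≤ min ((W ^ N) p.1 p.2) 1 :=
          mul_le_of_le_one_right (lt_min (hN _ _) one_pos).le (hw1 l)
      _ ≤ _ := (min_le_left _ _).trans (hp (k, l))
  have hcontr : ∀ y : ι → ℝ, w ⬝ᵥ y = 0 → ‖(W ^ N) *ᵥ y‖ ≤ (1 - δ) * ‖y‖ := fun y =>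
    norm_mulVec_le_of_dotProduct_eq_zero (pow_mulVec_one h1 N) hδP hs
  set c := w ⬝ᵥ x 0 with hc
  have hwW : ∀ y, w ⬝ᵥ (W *ᵥ y) = w ⬝ᵥ y := fun y => by rw [Matrix.dotProduct_mulVec, hw]
  have hcons : ∀ t, w ⬝ᵥ x t = c := by
    intro t
    induction t with
    | zero => rfl
    | succ t ih => rw [hx, dotProduct_sub, dotProduct_sub, hwW, hwW, sub_self, sub_zero, ih]
  have hwone : w ⬝ᵥ (1 : ι → ℝ) = 1 := by simpa [dotProduct] using hs
  let y : ℕ → ι → ℝ := fun t => x t - c • 1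
  have hyw : ∀ t, w ⬝ᵥ y t = 0 := fun t => by
    simp [y, dotProduct_sub, dotProduct_smul, hcons, hwone]
  have hyrec : ∀ t, y (t + 1) = W *ᵥ y t + -(e t - W *ᵥ e t) := fun t => by
    simp only [y, hx, Matrix.mulVec_sub, Matrix.mulVec_smul, h1]
    abel
  have hvbd : ∀ t, ‖-(e t - W *ᵥ e t)‖ ≤ 2 * C := fun t => by
    rw [norm_neg]
    linarith [norm_sub_le (e t) (W *ᵥ e t), norm_mulVec_le h0 h1 (e t), he t]
  have hbd := bounded_of_recursion h0 h1 hδ hδ1 hvbd hyrec fun t => hcontr _ (hyw t)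
  set B := ‖y 0‖ + N * (2 * C) / δ
  let ya : ℕ → ι → ℝ := fun m => (1 / (m : ℝ)) • ∑ s ∈ Finset.range m, y s
  let ea : ℕ → ι → ℝ := fun m => (1 / (m : ℝ)) • ∑ s ∈ Finset.range m, e s
  have hea : Tendsto ea atTop (𝓝 0) := by
    refine tendsto_pi_nhds.2 fun k => ?_
    simpa [ea] using hlim k
  have htel : ∀ m, ya m - W *ᵥ ya m
      = -((1 / (m : ℝ)) • (y m - y 0)) - (ea m - W *ᵥ ea m) := by
    intro m
    have : y m - y 0 = -(∑ s ∈ Finset.range m, y s - W *ᵥ ∑ s ∈ Finset.range m, y s)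
        - (∑ s ∈ Finset.range m, e s - W *ᵥ ∑ s ∈ Finset.range m, e s) := by
      rw [← Finset.sum_range_sub]
      simp_rw [Matrix.mulVec_sum, ← Finset.sum_sub_distrib, ← Finset.sum_neg_distrib,
        ← Finset.sum_sub_distrib]
      refine Finset.sum_congr rfl fun s _ => ?_
      rw [hyrec]
      abel
    rw [this]
    simp only [ya, ea, Matrix.mulVec_smul, ← smul_sub, ← smul_neg]
    congr 1
    abel
  have hyaw : ∀ m, w ⬝ᵥ ya m = 0 := fun m => by
    simp [ya, dotProduct_smul, dotProduct_sum, hyw]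
  -- From `‖ya‖ ≤ (1 - δ) ‖ya‖ + N ‖ya - W ya‖`, absorb the first term on the left and insert the
  -- telescoped identity.
  have hest : ∀ m, ‖ya m‖ ≤ N / δ * (1 / (m : ℝ) * (2 * B) + 2 * ‖ea m‖) := by
    intro m
    have e1 := norm_le_norm_add_norm_sub' (ya m) ((W ^ N) *ᵥ ya m)
    have e2 := norm_sub_pow_mulVec_le_mul h0 h1 (ya m) N
    have e3 := hcontr _ (hyaw m)
    have e4 : ‖ya m - W *ᵥ ya m‖ ≤ 1 / (m : ℝ) * (2 * B) + 2 * ‖ea m‖ := by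
      rw [htel]
      refine (norm_sub_le _ _).trans (add_le_add ?_ ?_)
      · rw [norm_neg, norm_smul, Real.norm_of_nonneg (by positivity)]
        refine mul_le_mul_of_nonneg_left ?_ (by positivity)
        linarith [norm_sub_le (y m) (y 0), hbd m, hbd 0]
      · linarith [norm_sub_le (ea m) (W *ᵥ ea m), norm_mulVec_le h0 h1 (ea m)]
    have e5 := mul_le_mul_of_nonneg_left e4 (Nat.cast_nonneg (α := ℝ) N)
    rw [div_mul_eq_mul_div, le_div_iff₀ hδ]
    linarith
  have hya : Tendsto ya atTop (𝓝 0) := by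
    refine squeeze_zero_norm hest ?_
    have := ((tendsto_one_div_atTop_nhds_zero_nat (𝕜 := ℝ)).mul_const (2 * B)).add
      (hea.norm.const_mul 2)
    simpa using this.const_mul (N / δ)
  have hyi := (tendsto_pi_nhds.1 hya i).add_const c
  rw [Pi.zero_apply, zero_add] at hyi
  refine hyi.congr' ?_
  filter_upwards [eventually_gt_atTop 0] with m hm
  have hm' : (m : ℝ) ≠ 0 := by positivity
  simp [ya, y, Finset.sum_apply, Finset.sum_sub_distrib]
  field_simp
  ring

end StochasticMatrix

/-! ### Strong law for bounded orthogonal variables; independent inputs -/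

section Probability

variable {Ω : Type*} [MeasurableSpace Ω] {μ : Measure Ω}

theorem integral_sq_sum_range_le [IsProbabilityMeasure μ] {X : ℕ → Ω → ℝ} {C : ℝ}
    (hX : ∀ k, Measurable (X k)) (hb : ∀ k, ∀ᵐ ω ∂μ, |X k ω| ≤ C)
    (ho : ∀ k l, k < l → ∫ ω, X k ω * X l ω ∂μ = 0) (m : ℕ) :
    Integrable (fun ω => (∑ s ∈ Finset.range m, X s ω) ^ 2) μ ∧
    ∫ ω, (∑ s ∈ Finset.range m, X s ω) ^ 2 ∂μ ≤ m * C ^ 2 := by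
  have hLp : ∀ k, MemLp (X k) 2 μ := fun k =>
    MemLp.of_bound (hX k).aestronglyMeasurable C (by simpa using hb k)
  have hS : ∀ m, MemLp (fun ω => ∑ s ∈ Finset.range m, X s ω) 2 μ := fun m =>
    memLp_finsetSum _ fun k _ => hLp k
  refine ⟨(hS m).integrable_sq, ?_⟩
  induction m with
  | zero => simp
  | succ m ih =>
    have hcross : ∫ ω, (∑ s ∈ Finset.range m, X s ω) * X m ω ∂μ = 0 := by
      simp_rw [Finset.sum_mul]
      rw [integral_finsetSum (f := fun k ω => X k ω * X m ω) _
        fun k _ => (hLp k).integrable_mul (hLp m)]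
      exact Finset.sum_eq_zero fun k hk => ho k m (Finset.mem_range.1 hk)
    have hsq : ∫ ω, X m ω ^ 2 ∂μ ≤ C ^ 2 := by
      calc ∫ ω, X m ω ^ 2 ∂μ ≤ ∫ _, C ^ 2 ∂μ := by
            refine integral_mono_ae (hLp m).integrable_sq (integrable_const _) ?_
            filter_upwards [hb m] with ω h
            exact sq_le_sq' (abs_le.1 h).1 (abs_le.1 h).2
        _ = C ^ 2 := by simp
    have hi : Integrable (fun ω => (∑ s ∈ Finset.range m, X s ω) * X m ω) μ :=
      (hS m).integrable_mul (hLp m)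
    have : ∀ ω, (∑ s ∈ Finset.range (m + 1), X s ω) ^ 2 = (∑ s ∈ Finset.range m, X s ω) ^ 2
        + 2 * ((∑ s ∈ Finset.range m, X s ω) * X m ω) + X m ω ^ 2 := fun ω => by
      rw [Finset.sum_range_succ]
      ring
    simp_rw [this]
    rw [integral_add (f := fun ω => (∑ s ∈ Finset.range m, X s ω) ^ 2
        + 2 * ((∑ s ∈ Finset.range m, X s ω) * X m ω))
        ((hS m).integrable_sq.add (hi.const_mul 2)) (hLp m).integrable_sq,
      integral_add (hS m).integrable_sq (hi.const_mul 2), integral_const_mul, hcross]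
    push_cast
    linarith

/-- If a series of integrals of nonnegative functions converges, the functions tend to zero almost
everywhere. -/
theorem ae_tendsto_zero_of_summable_integral {f : ℕ → Ω → ℝ} (hf : ∀ k, Integrable (f k) μ)
    (h0 : ∀ k ω, 0 ≤ f k ω) (hs : Summable fun k => ∫ ω, f k ω ∂μ) :
    ∀ᵐ ω ∂μ, Tendsto (fun k => f k ω) atTop (𝓝 0) := by
  have hlint : ∑' k, ∫⁻ ω, ENNReal.ofReal (f k ω) ∂μ ≠ ⊤ := by
    simp_rw [← ofReal_integral_eq_lintegral_ofReal (hf _) (ae_of_all _ (h0 _))]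
    exact hs.tsum_ofReal_ne_top
  rw [← lintegral_tsum fun k => (hf k).1.aemeasurable.ennreal_ofReal] at hlint
  have hae := ae_lt_top' (AEMeasurable.tsum
    fun k => (hf k).1.aemeasurable.ennreal_ofReal) hlint
  filter_upwards [hae] with ω hω
  have := (ENNReal.tendsto_toReal ENNReal.zero_ne_top).comp
    (ENNReal.tendsto_atTop_zero_of_tsum_ne_top hω.ne)
  refine this.congr fun k => ?_
  simp [ENNReal.toReal_ofReal (h0 k ω)]

/-- Averages of a bounded sequence vanish in the limit if they do so along the squares. -/
theorem tendsto_average_of_tendsto_sq {a : ℕ → ℝ} {C : ℝ} (ha : ∀ k, |a k| ≤ C)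
    (h : Tendsto (fun k : ℕ => (1 / ((k ^ 2 : ℕ) : ℝ)) * ∑ s ∈ Finset.range (k ^ 2), a s) atTop
      (𝓝 0)) :
    Tendsto (fun m : ℕ => (1 / (m : ℝ)) * ∑ s ∈ Finset.range m, a s) atTop (𝓝 0) := by
  have hC : 0 ≤ C := (abs_nonneg _).trans (ha 0)
  have hsqrt : Tendsto Nat.sqrt atTop atTop := by
    refine tendsto_atTop.2 fun b => ?_
    filter_upwards [eventually_ge_atTop (b * b)] with m hm
    exact Nat.le_sqrt.2 hm
  have hb : Tendsto (fun m : ℕ =>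
      |(1 / ((m.sqrt ^ 2 : ℕ) : ℝ)) * ∑ s ∈ Finset.range (m.sqrt ^ 2), a s|
      + 2 * C * (1 / (m.sqrt : ℝ))) atTop (𝓝 0) := by
    have := ((h.comp hsqrt).abs).add
      (((tendsto_one_div_atTop_nhds_zero_nat (𝕜 := ℝ)).comp hsqrt).const_mul (2 * C))
    simpa using this
  refine squeeze_zero_norm' ?_ hb
  filter_upwards [eventually_gt_atTop 0] with m hm
  set k := m.sqrt
  have hk0 : 0 < k := Nat.sqrt_pos.2 hm
  have hkm : k ^ 2 ≤ m := Nat.sqrt_le' m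
  have hmk : m ≤ k ^ 2 + 2 * k := by
    have := Nat.sqrt_le_add m
    simp only [k]
    nlinarith
  have hkR : (0 : ℝ) < k := by exact_mod_cast hk0
  have hkmR : (k : ℝ) ^ 2 ≤ m := by exact_mod_cast hkm
  have hmkR : (m : ℝ) ≤ k ^ 2 + 2 * k := by exact_mod_cast hmk
  have hmR : (0 : ℝ) < m := by exact_mod_cast hm
  -- At most `2 k` terms lie between `k ^ 2` and `m`; after division by `k ^ 2` they cost `2 C / k`.
  have hsplit : |∑ s ∈ Finset.range m, a s| ≤ |∑ s ∈ Finset.range (k ^ 2), a s| + 2 * k * C := by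
    rw [← Finset.sum_range_add_sum_Ico _ hkm]
    refine (abs_add_le _ _).trans (add_le_add_right ?_ _)
    calc |∑ s ∈ Finset.Ico (k ^ 2) m, a s| ≤ ∑ s ∈ Finset.Ico (k ^ 2) m, C :=
          (Finset.abs_sum_le_sum_abs _ _).trans (Finset.sum_le_sum fun s _ => ha s)
      _ = (m - k ^ 2 : ℝ) * C := by
          rw [Finset.sum_const, Nat.card_Ico, nsmul_eq_mul, Nat.cast_sub hkm]
          push_cast
          rfl
      _ ≤ 2 * k * C := by
          gcongr
          linarith
  rw [Real.norm_eq_abs, abs_mul, abs_mul, abs_of_nonneg (by positivity : 0 ≤ 1 / (m : ℝ)),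
    abs_of_nonneg (by positivity : 0 ≤ 1 / ((k ^ 2 : ℕ) : ℝ))]
  have hle : 1 / (m : ℝ) ≤ 1 / ((k ^ 2 : ℕ) : ℝ) := by
    push_cast
    gcongr
  calc _ ≤ 1 / ((k ^ 2 : ℕ) : ℝ) * (|∑ s ∈ Finset.range (k ^ 2), a s| + 2 * k * C) := by
        gcongr
    _ = _ := by
        push_cast
        field_simp

/-- The strong law of large numbers for bounded orthogonal random variables. -/
theorem ae_tendsto_average_of_orthogonal [IsProbabilityMeasure μ] {X : ℕ → Ω → ℝ} {C : ℝ}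
    (hX : ∀ k, Measurable (X k)) (hb : ∀ k, ∀ᵐ ω ∂μ, |X k ω| ≤ C)
    (ho : ∀ k l, k < l → ∫ ω, X k ω * X l ω ∂μ = 0) :
    ∀ᵐ ω ∂μ, Tendsto (fun m : ℕ => (1 / (m : ℝ)) * ∑ s ∈ Finset.range m, X s ω) atTop (𝓝 0) := by
  have hS := integral_sq_sum_range_le hX hb ho
  have hsq := ae_tendsto_zero_of_summable_integral (μ := μ)
    (f := fun k ω => ((1 / ((k ^ 2 : ℕ) : ℝ)) * ∑ s ∈ Finset.range (k ^ 2), X s ω) ^ 2)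
    (fun k => by
      simp_rw [mul_pow]
      exact (hS _).1.const_mul _) (fun k ω => sq_nonneg _) (by
      -- The average over `k ^ 2` terms has second moment at most `C ^ 2 / k ^ 2`; passing to
      -- squares is what makes this summable.
      have hsum : Summable fun k : ℕ => C ^ 2 * (1 / (k : ℝ) ^ 2) :=
        (Real.summable_one_div_nat_pow.2 one_lt_two).mul_left _
      refine Summable.of_nonneg_of_le (fun k => integral_nonneg fun ω => sq_nonneg _)
        (fun k => ?_) hsum
      simp_rw [mul_pow]
      rw [integral_const_mul]
      refine (mul_le_mul_of_nonneg_left (hS (k ^ 2)).2 (by positivity)).trans_eq ?_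
      rcases eq_or_ne (k : ℝ) 0 with hk | hk
      · simp [hk]
      · push_cast
        field_simp)
  filter_upwards [hsq, ae_all_iff.2 hb] with ω hω hbω
  refine tendsto_average_of_tendsto_sq hbω ?_
  have h := hω.sqrt
  simp_rw [Real.sqrt_sq_eq_abs, Real.sqrt_zero] at h
  exact (tendsto_zero_iff_abs_tendsto_zero _).2 h

variable {E Ω' : Type*} [MeasurableSpace E] [MeasurableSpace Ω']

/-- A property that holds almost surely for every fixed input holds almost surely for an
independent random input. -/
theorem ae_of_indepFun [IsProbabilityMeasure μ] {X : Ω → E} {g : Ω → Ω'} (hX : Measurable X)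
    (hg : Measurable g) (h : IndepFun X g μ) {S : Set (E × Ω')} (hS : MeasurableSet S)
    (hx : ∀ x, ∀ᵐ ω ∂μ, (x, g ω) ∈ S) : ∀ᵐ ω ∂μ, (X ω, g ω) ∈ S := by
  have hm := (indepFun_iff_map_prod_eq_prod_map_map hX.aemeasurable hg.aemeasurable).1 h
  have := Measure.isProbabilityMeasure_map (μ := μ) hg.aemeasurable
  refine (ae_map_iff (hX.prodMk hg).aemeasurable hS).1 ?_
  rw [hm]
  refine (Measure.ae_prod_iff_ae_ae hS).2 (ae_of_all _ fun x => ?_)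
  exact (ae_map_iff hg.aemeasurable (measurable_prodMk_left hS)).2 (hx x)

/-- A function whose mean vanishes for every fixed input has mean zero at an independent random
input. -/
theorem integral_eq_zero_of_indepFun [IsProbabilityMeasure μ] {X : Ω → E} {g : Ω → Ω'}
    (hX : Measurable X) (hg : Measurable g) (h : IndepFun X g μ) {F : E × Ω' → ℝ}
    (hF : Measurable F) (hi : Integrable (fun ω => F (X ω, g ω)) μ)
    (hx : ∀ x, ∫ ω, F (x, g ω) ∂μ = 0) : ∫ ω, F (X ω, g ω) ∂μ = 0 := by
  have hm := (indepFun_iff_map_prod_eq_prod_map_map hX.aemeasurable hg.aemeasurable).1 h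
  have := Measure.isProbabilityMeasure_map (μ := μ) hg.aemeasurable
  have := Measure.isProbabilityMeasure_map (μ := μ) hX.aemeasurable
  have hXg := (hX.prodMk hg).aemeasurable (μ := μ)
  rw [← integral_map (φ := fun ω => (X ω, g ω)) hXg hF.aestronglyMeasurable, hm, integral_prod]
  · refine integral_eq_zero_of_ae (ae_of_all _ fun x => ?_)
    exact (integral_map hg.aemeasurable
      (hF.comp measurable_prodMk_left).aestronglyMeasurable).trans (hx x)
  · rw [← hm]
    exact (integrable_map_measure hF.aestronglyMeasurable hXg).2 hi

end Probability

/-! ### Bounded, unbiased error at a fixed input -/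

section Quantizer

variable {Ω : Type*} [MeasurableSpace Ω] {μ : Measure Ω}

theorem IsProbabilisticQuantizer.error [IsProbabilityMeasure μ] {Δ : ℝ} (hΔ : 0 < Δ)
    {Q : ℝ → Ω → ℝ} (hQ : IsProbabilisticQuantizer μ Δ Q) (x : ℝ) (hm : Measurable (Q x)) :
    (∀ᵐ ω ∂μ, |Q x ω - x| ≤ Δ) ∧ ∫ ω, (Q x ω - x) ∂μ = 0 := by
  have hx : x / Δ * Δ = x := div_mul_cancel₀ _ hΔ.ne'
  have hfl := Int.floor_le (x / Δ)
  have hfl' := Int.lt_floor_add_one (x / Δ)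
  have hce := Int.le_ceil (x / Δ)
  have hce' := Int.ceil_lt_add_one (x / Δ)
  have hp0 : 0 ≤ x / Δ - ⌊x / Δ⌋ := by linarith
  have hp1 : 0 ≤ 1 - (x / Δ - ⌊x / Δ⌋) := by linarith
  constructor
  · refine (ae_map_iff (p := fun y => |y - x| ≤ Δ) hm.aemeasurable
      (measurableSet_le (by fun_prop) measurable_const)).1 ?_
    rw [hQ x, ae_add_measure_iff]
    refine ⟨Measure.ae_smul_measure ?_ _, Measure.ae_smul_measure ?_ _⟩
    all_goals
      rw [ae_dirac_iff (measurableSet_le (by fun_prop) measurable_const), abs_le]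
      constructor <;> nlinarith
  · rw [← integral_map (f := fun y => y - x) hm.aemeasurable (by fun_prop), hQ x,
      integral_add_measure ((integrable_dirac (by simp)).smul_measure ENNReal.ofReal_ne_top)
        ((integrable_dirac (by simp)).smul_measure ENNReal.ofReal_ne_top),
      integral_smul_measure, integral_smul_measure, integral_dirac, integral_dirac,
      ENNReal.toReal_ofReal hp0, ENNReal.toReal_ofReal hp1, smul_eq_mul, smul_eq_mul]
    -- On the grid floor and ceiling coincide; off it they differ by one and the weighted mean is
    -- `x`.
    rcases eq_or_ne (x / Δ - ⌊x / Δ⌋) 0 with h | h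
    · have : (⌊x / Δ⌋ : ℝ) = x / Δ := by linarith
      rw [h, this, hx]
      ring
    · have hc : (⌈x / Δ⌉ : ℝ) = ⌊x / Δ⌋ + 1 := by
        have : ⌈x / Δ⌉ = ⌊x / Δ⌋ + 1 := by
          refine Int.ceil_eq_iff.2 ⟨?_, by push_cast; linarith⟩
          push_cast
          have := lt_of_le_of_ne hp0 h.symm
          linarith
        exact_mod_cast this
      rw [hc]
      linear_combination hx

theorem quantizer_error [IsProbabilityMeasure μ] {Δ : ℝ} (hΔ : 0 < Δ) {Q : ℝ → Ω → ℝ}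
    (hQ : IsProbabilisticQuantizer μ Δ Q ∨ IsDitheredQuantizer μ Δ Q) (x : ℝ)
    (hm : Measurable (Q x)) :
    (∀ᵐ ω ∂μ, |Q x ω - x| ≤ Δ) ∧ ∫ ω, (Q x ω - x) ∂μ = 0 := by
  rcases hQ with hQ | ⟨u, hu, hb, -, h0⟩
  · exact hQ.error hΔ x hm
  · simpa [hu] using ⟨hb, h0⟩

end Quantizer

/-! ### The consensus matrix of the graph -/

namespace WeightedDigraph

variable {n : ℕ} (G : WeightedDigraph n)

theorem sum_neighbors_weight_mul (i : Fin n) (f : Fin n → ℝ) :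
    ∑ k ∈ G.neighbors i, G.weight i k * f k = ∑ k, G.weight i k * f k := by
  refine Finset.sum_subset (Finset.subset_univ _) fun k _ hk => ?_
  rw [G.weight_eq_zero i k (by simpa [neighbors] using hk), zero_mul]

theorem weight_nonneg (i j : Fin n) : 0 ≤ G.weight i j := by
  by_cases h : G.Adj j i
  · exact (G.weight_pos i j h).le
  · exact (G.weight_eq_zero i j h).ge

theorem laplacian_mulVec (x : Fin n → ℝ) (i : Fin n) :
    (G.laplacian *ᵥ x) i = -∑ k ∈ G.neighbors i, G.weight i k * (x k - x i) := by
  have h := G.sum_neighbors_weight_mul i x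
  simp_rw [mul_sub, Finset.sum_sub_distrib, h, ← Finset.sum_mul]
  rw [laplacian, Matrix.sub_mulVec, Pi.sub_apply, Matrix.mulVec_diagonal, inDegree]
  simp [Matrix.mulVec, dotProduct]

theorem laplacian_mulVec_one : G.laplacian *ᵥ 1 = 0 := by
  ext i
  simp [laplacian_mulVec]

/-- The matrix `I - α L` of the unquantized consensus iteration. -/
noncomputable def consensusMatrix (α : ℝ) : Matrix (Fin n) (Fin n) ℝ :=
  1 - α • G.laplacian

variable {G} {α : ℝ}

theorem consensusMatrix_mulVec (x : Fin n → ℝ) :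
    G.consensusMatrix α *ᵥ x = x - α • (G.laplacian *ᵥ x) := by
  rw [consensusMatrix, Matrix.sub_mulVec, Matrix.one_mulVec, Matrix.smul_mulVec]

theorem consensusMatrix_mulVec_one : G.consensusMatrix α *ᵥ 1 = 1 := by
  rw [consensusMatrix_mulVec, laplacian_mulVec_one, smul_zero, sub_zero]

theorem vecMul_consensusMatrix {w : Fin n → ℝ} (hw : w ᵥ* G.laplacian = 0) :
    w ᵥ* G.consensusMatrix α = w := by
  rw [consensusMatrix, Matrix.vecMul_sub, Matrix.vecMul_one, Matrix.vecMul_smul, hw, smul_zero,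
    sub_zero]

theorem consensusMatrix_apply_self (i : Fin n) :
    G.consensusMatrix α i i = 1 - α * G.inDegree i := by
  simp [consensusMatrix, laplacian, G.weight_eq_zero i i (G.no_loop i)]

theorem consensusMatrix_apply_ne {i j : Fin n} (h : i ≠ j) :
    G.consensusMatrix α i j = α * G.weight i j := by
  simp [consensusMatrix, laplacian, h]

theorem consensusMatrix_nonneg (hα : 0 < α) (hαd : ∀ i, α * G.inDegree i < 1) (i j : Fin n) :
    0 ≤ G.consensusMatrix α i j := by
  rcases eq_or_ne i j with rfl | h
  · rw [consensusMatrix_apply_self]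
    linarith [hαd i]
  · rw [consensusMatrix_apply_ne h]
    exact mul_nonneg hα.le (G.weight_nonneg i j)

theorem exists_consensusMatrix_pow_pos (hG : G.StronglyConnected) (hα : 0 < α)
    (hαd : ∀ i, α * G.inDegree i < 1) : ∃ N, ∀ i j, 0 < (G.consensusMatrix α ^ N) i j := by
  refine exists_pow_pos (consensusMatrix_nonneg hα hαd) (fun i => ?_) (r := G.Adj)
    (fun i j hij => ?_) hG
  · rw [consensusMatrix_apply_self]
    linarith [hαd i]
  · have h : i ≠ j := by
      rintro rfl
      exact G.no_loop i hij
    rw [consensusMatrix_apply_ne h]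
    exact mul_pos hα (G.weight_pos i j hij)

end WeightedDigraph

/-! ### The state recursion and its adaptedness -/

section StateProcess

variable {Ω : Type*} {n : ℕ}

/-- The quantization error of the entry `j` at node `i` and time `t`. -/
noncomputable def stateError (G : WeightedDigraph n) (α : ℝ) (Q : ℕ → Fin n → Fin n → ℝ → Ω → ℝ)
    (t : ℕ) (i j : Fin n) (ω : Ω) : ℝ :=
  Q t i j (state G α Q t i j ω) ω - state G α Q t i j ω

/-- Because `α L = I - W`, the errors enter only through `I - W`; this is why `w` does not see them.
-/
theorem state_succ (G : WeightedDigraph n) (α : ℝ) (Q : ℕ → Fin n → Fin n → ℝ → Ω → ℝ) (t : ℕ)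
    (j : Fin n) (ω : Ω) :
    (fun i => state G α Q (t + 1) i j ω) = G.consensusMatrix α *ᵥ (fun i => state G α Q t i j ω)
      - ((fun i => stateError G α Q t i j ω)
        - G.consensusMatrix α *ᵥ (fun i => stateError G α Q t i j ω)) := by
  ext i
  simp only [WeightedDigraph.consensusMatrix_mulVec, Pi.sub_apply, Pi.smul_apply,
    WeightedDigraph.laplacian_mulVec, smul_eq_mul, state, stateError]
  have : ∀ k, G.weight i k * (Q t k j (state G α Q t k j ω) ω - Q t i j (state G α Q t i j ω) ω)
      = G.weight i k * (state G α Q t k j ω - state G α Q t i j ω)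
      + G.weight i k * (Q t k j (state G α Q t k j ω) ω - state G α Q t k j ω
        - (Q t i j (state G α Q t i j ω) ω - state G α Q t i j ω)) := fun k => by ring
  simp_rw [this, Finset.sum_add_distrib]
  ring

/-- The randomness of all quantizers used before time `t`. -/
abbrev sourcesBefore (𝓖 : ℕ × Fin n → MeasurableSpace Ω) (t : ℕ) : MeasurableSpace Ω :=
  ⨆ p ∈ {p : ℕ × Fin n | p.1 < t}, 𝓖 p

variable {G : WeightedDigraph n} {α : ℝ} {Q : ℕ → Fin n → Fin n → ℝ → Ω → ℝ}
  {𝓖 : ℕ × Fin n → MeasurableSpace Ω}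

theorem sourcesBefore_mono {s t : ℕ} (h : s ≤ t) : sourcesBefore 𝓖 s ≤ sourcesBefore 𝓖 t :=
  biSup_mono fun _ hp => lt_of_lt_of_le hp h

theorem le_sourcesBefore {s t : ℕ} (h : s < t) (i : Fin n) : 𝓖 (s, i) ≤ sourcesBefore 𝓖 t :=
  le_biSup (f := 𝓖) (i := (s, i)) h

theorem measurable_stateError_of_measurable_state
    (hQ : ∀ t i j, Measurable[MeasurableSpace.prod (borel ℝ) (𝓖 (t, i))]
      fun p : ℝ × Ω => Q t i j p.1 p.2 - p.1) {t : ℕ} {i j : Fin n}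
    (h : Measurable[sourcesBefore 𝓖 t] (state G α Q t i j)) :
    Measurable[sourcesBefore 𝓖 (t + 1)] (stateError G α Q t i j) := by
  have h1 : Measurable[sourcesBefore 𝓖 (t + 1)] (state G α Q t i j) :=
    h.mono (sourcesBefore_mono t.le_succ) le_rfl
  have h2 : Measurable[sourcesBefore 𝓖 (t + 1), 𝓖 (t, i)] (id : Ω → Ω) :=
    measurable_id'' (le_sourcesBefore t.lt_succ_self i)
  have h3 : Measurable[sourcesBefore 𝓖 (t + 1), MeasurableSpace.prod (borel ℝ) (𝓖 (t, i))]
      fun ω => (state G α Q t i j ω, ω) := Measurable.prodMk h1 h2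
  exact (hQ t i j).comp h3

theorem measurable_state
    (hQ : ∀ t i j, Measurable[MeasurableSpace.prod (borel ℝ) (𝓖 (t, i))]
      fun p : ℝ × Ω => Q t i j p.1 p.2 - p.1) (t : ℕ) (i j : Fin n) :
    Measurable[sourcesBefore 𝓖 t] (state G α Q t i j) := by
  induction t generalizing i j with
  | zero => exact @measurable_const _ _ _ (_) _
  | succ t ih =>
    have hs : ∀ i, Measurable[sourcesBefore 𝓖 (t + 1)] (state G α Q t i j) := fun i =>
      (ih i j).mono (sourcesBefore_mono t.le_succ) le_rfl
    have he : ∀ i, Measurable[sourcesBefore 𝓖 (t + 1)] (stateError G α Q t i j) := fun i =>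
      measurable_stateError_of_measurable_state hQ (ih i j)
    have hq : ∀ i, Measurable[sourcesBefore 𝓖 (t + 1)]
        (fun ω => Q t i j (state G α Q t i j ω) ω) := fun i => by
      have : (fun ω => Q t i j (state G α Q t i j ω) ω)
          = fun ω => stateError G α Q t i j ω + state G α Q t i j ω := by
        ext ω
        simp [stateError]
      rw [this]
      exact (he i).add (hs i)
    exact (hs i).add ((Finset.measurable_sum _ fun k _ =>
      ((hq k).sub (hq i)).const_mul _).const_mul _)

end StateProcess

/-! ### Boundedness and orthogonality of the errors along the trajectory -/

section Errors

variable {Ω : Type*} [mΩ : MeasurableSpace Ω] {μ : Measure Ω} {n : ℕ} {G : WeightedDigraph n}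
  {α : ℝ} {Q : ℕ → Fin n → Fin n → ℝ → Ω → ℝ} {𝓖 : ℕ × Fin n → MeasurableSpace Ω}

theorem sourcesBefore_le (hle : ∀ p, 𝓖 p ≤ mΩ) (t : ℕ) : sourcesBefore 𝓖 t ≤ mΩ :=
  iSup₂_le fun p _ => hle p

theorem indep_sourcesBefore (hle : ∀ p, 𝓖 p ≤ mΩ) (hi : iIndep 𝓖 μ) (t : ℕ) (i : Fin n) :
    Indep (sourcesBefore 𝓖 t) (𝓖 (t, i)) μ := by
  have h := indep_iSup_of_disjoint hle hi (S := {p : ℕ × Fin n | p.1 < t}) (T := {(t, i)})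
    (by simp)
  simpa [sourcesBefore] using h

/-- The source is viewed as a random element, the identity into `Ω` with the smaller σ-algebra `𝓗`,
so that the lemmas on independent inputs apply to it. -/
theorem indepFun_id_of_indep {E : Type*} [MeasurableSpace E] {𝓕 𝓗 : MeasurableSpace Ω}
    (h : Indep 𝓕 𝓗 μ) {X : Ω → E} (hX : Measurable[𝓕] X) :
    @IndepFun Ω E Ω mΩ _ 𝓗 X id μ := by
  refine (@IndepFun_iff_Indep Ω E Ω mΩ _ 𝓗 X id μ).2 ?_
  rw [MeasurableSpace.comap_id]
  exact indep_of_indep_of_le_left h hX.comap_le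

theorem measurable_stateError (hle : ∀ p, 𝓖 p ≤ mΩ)
    (hQm : ∀ t i j, Measurable[MeasurableSpace.prod (borel ℝ) (𝓖 (t, i))]
      fun p : ℝ × Ω => Q t i j p.1 p.2 - p.1) (t : ℕ) (i j : Fin n) :
    Measurable (stateError G α Q t i j) :=
  (measurable_stateError_of_measurable_state hQm (measurable_state hQm t i j)).mono
    (sourcesBefore_le hle _) le_rfl

theorem measurable_quantizer (hle : ∀ p, 𝓖 p ≤ mΩ)
    (hQm : ∀ t i j, Measurable[MeasurableSpace.prod (borel ℝ) (𝓖 (t, i))]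
      fun p : ℝ × Ω => Q t i j p.1 p.2 - p.1) (t : ℕ) (i j : Fin n) (x : ℝ) :
    Measurable (Q t i j x) := by
  have h : Measurable[𝓖 (t, i)] fun ω => Q t i j x ω - x :=
    (hQm t i j).comp (@measurable_prodMk_left ℝ Ω (borel ℝ) (𝓖 (t, i)) x)
  simpa using (h.mono (hle _) le_rfl).add_const x

theorem ae_abs_stateError_le [IsProbabilityMeasure μ] {Δ : ℝ} (hΔ : 0 < Δ)
    (hQ : ∀ t i j, IsProbabilisticQuantizer μ Δ (Q t i j) ∨ IsDitheredQuantizer μ Δ (Q t i j))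
    (hle : ∀ p, 𝓖 p ≤ mΩ) (hi : iIndep 𝓖 μ)
    (hQm : ∀ t i j, Measurable[MeasurableSpace.prod (borel ℝ) (𝓖 (t, i))]
      fun p : ℝ × Ω => Q t i j p.1 p.2 - p.1) (t : ℕ) (i j : Fin n) :
    ∀ᵐ ω ∂μ, |stateError G α Q t i j ω| ≤ Δ := by
  have hs := measurable_state (G := G) (α := α) hQm t i j
  have hm : @MeasurableSet (ℝ × Ω) (MeasurableSpace.prod (borel ℝ) (𝓖 (t, i)))
      {p : ℝ × Ω | |Q t i j p.1 p.2 - p.1| ≤ Δ} :=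
    (hQm t i j) (measurableSet_le (f := fun y : ℝ => |y|) (by fun_prop) measurable_const)
  rw [← BorelSpace.measurable_eq (α := ℝ)] at hm
  exact @ae_of_indepFun Ω mΩ μ ℝ Ω _ (𝓖 (t, i)) _ (state G α Q t i j) id
    (hs.mono (sourcesBefore_le hle t) le_rfl) (measurable_id'' (hle _))
    (indepFun_id_of_indep (indep_sourcesBefore hle hi t i) hs) _ hm
    fun x => (quantizer_error hΔ (hQ t i j) x (measurable_quantizer hle hQm t i j x)).1

/-- The state at time `t` and the error at time `s < t` are both determined before `t`. With this
pair frozen, the integrand is a constant times a mean-zero error. -/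
theorem integral_stateError_mul [IsProbabilityMeasure μ] {Δ : ℝ} (hΔ : 0 < Δ)
    (hQ : ∀ t i j, IsProbabilisticQuantizer μ Δ (Q t i j) ∨ IsDitheredQuantizer μ Δ (Q t i j))
    (hle : ∀ p, 𝓖 p ≤ mΩ) (hi : iIndep 𝓖 μ)
    (hQm : ∀ t i j, Measurable[MeasurableSpace.prod (borel ℝ) (𝓖 (t, i))]
      fun p : ℝ × Ω => Q t i j p.1 p.2 - p.1) {s t : ℕ} (hst : s < t) (i j : Fin n) :
    ∫ ω, stateError G α Q s i j ω * stateError G α Q t i j ω ∂μ = 0 := by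
  have hs := measurable_state (G := G) (α := α) hQm t i j
  have he : Measurable[sourcesBefore 𝓖 t] (stateError G α Q s i j) :=
    (measurable_stateError_of_measurable_state hQm (measurable_state hQm s i j)).mono
      (sourcesBefore_mono hst) le_rfl
  have hX : Measurable[sourcesBefore 𝓖 t]
      fun ω => (state G α Q t i j ω, stateError G α Q s i j ω) :=
    Measurable.prodMk hs he
  have hQm' := hQm t i j
  rw [← BorelSpace.measurable_eq (α := ℝ)] at hQm'
  have hF : @Measurable ((ℝ × ℝ) × Ω) ℝ (@Prod.instMeasurableSpace _ _ _ (𝓖 (t, i))) _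
      fun p => p.1.2 * (Q t i j p.1.1 p.2 - p.1.1) := by
    let := 𝓖 (t, i)
    have h : Measurable fun p : (ℝ × ℝ) × Ω => (p.1.1, p.2) := by fun_prop
    exact Measurable.mul (by fun_prop) (hQm'.comp h)
  have hLp : ∀ t, MemLp (stateError G α Q t i j) 2 μ := fun t =>
    MemLp.of_bound (measurable_stateError hle hQm t i j).aestronglyMeasurable Δ
      (by simpa using ae_abs_stateError_le hΔ hQ hle hi hQm t i j)
  exact @integral_eq_zero_of_indepFun Ω mΩ μ (ℝ × ℝ) Ω _ (𝓖 (t, i)) _ _ id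
    (hX.mono (sourcesBefore_le hle t) le_rfl) (measurable_id'' (hle _))
    (indepFun_id_of_indep (indep_sourcesBefore hle hi t i) hX) _ hF
    ((hLp s).integrable_mul (hLp t))
    fun x => by
      refine (integral_const_mul x.2 _).trans ?_
      simp [(quantizer_error hΔ (hQ t i j) x.1 (measurable_quantizer hle hQm t i j x.1)).2]

end Errors

/-! ### Almost sure convergence and the random time -/

theorem runningAverage_eq {Ω : Type*} {n : ℕ} (G : WeightedDigraph n) (α : ℝ)
    (Q : ℕ → Fin n → Fin n → ℝ → Ω → ℝ) (k₀ K : ℕ) (i j : Fin n) (ω : Ω) :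
    runningAverage G α Q k₀ K i j ω
      = (1 / (K : ℝ)) * ∑ s ∈ Finset.range K, state G α Q (k₀ + 1 + s) i j ω := by
  rw [runningAverage, Finset.range_eq_Ico, Finset.sum_Ico_add (fun s => state G α Q s i j ω)]
  congr 2
  ext s
  simp only [Finset.mem_Icc, Finset.mem_Ico]
  omega

/-- The running averages of the quantized consensus iteration converge almost surely to the left
eigenvector of the Laplacian. -/
theorem ae_tendsto_runningAverage {n : ℕ} {G : WeightedDigraph n} (hG : G.StronglyConnected)
    {w : Fin n → ℝ} (hw : w ᵥ* G.laplacian = 0) (hw1 : ∑ i, w i = 1) {α : ℝ} (hα : 0 < α)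
    (hαd : ∀ i, α * G.inDegree i < 1) {Δ : ℝ} (hΔ : 0 < Δ) {Ω : Type*} [MeasurableSpace Ω]
    {μ : Measure Ω} [IsProbabilityMeasure μ] {Q : ℕ → Fin n → Fin n → ℝ → Ω → ℝ}
    (hQ : ∀ t i j, IsProbabilisticQuantizer μ Δ (Q t i j) ∨ IsDitheredQuantizer μ Δ (Q t i j))
    (hind : ErrorsIndependent μ Q) (k₀ : ℕ) :
    ∀ᵐ ω ∂μ, ∀ i j, Tendsto (fun K => runningAverage G α Q k₀ K i j ω) atTop (𝓝 (w j)) := by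
  obtain ⟨𝓖, hle, hi, hQm⟩ := hind
  obtain ⟨N, hN⟩ := WeightedDigraph.exists_consensusMatrix_pow_pos hG hα hαd
  have hb := fun t i j => ae_abs_stateError_le (G := G) (α := α) hΔ hQ hle hi hQm t i j
  have hlln := fun i j => ae_tendsto_average_of_orthogonal (μ := μ)
    (X := fun s => stateError G α Q (k₀ + 1 + s) i j)
    (fun s => measurable_stateError hle hQm _ i j) (fun s => hb _ i j)
    fun s t hst => integral_stateError_mul hΔ hQ hle hi hQm (by omega) i j
  simp_rw [← ae_all_iff] at hb hlln
  filter_upwards [hb, hlln] with ω hbω hω i j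
  simp_rw [runningAverage_eq]
  have hwW := WeightedDigraph.vecMul_consensusMatrix (α := α) hw
  have hmean : ∀ t, w ⬝ᵥ (fun i => state G α Q t i j ω) = w j := by
    intro t
    induction t with
    | zero => simp [state, dotProduct]
    | succ t ih =>
      rw [state_succ, dotProduct_sub, dotProduct_sub, Matrix.dotProduct_mulVec,
        Matrix.dotProduct_mulVec, hwW, sub_self, sub_zero, ih]
  rw [← hmean (k₀ + 1)]
  exact tendsto_average_of_recursion (WeightedDigraph.consensusMatrix_nonneg hα hαd)
    WeightedDigraph.consensusMatrix_mulVec_one hN hwW hw1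
    (x := fun s i => state G α Q (k₀ + 1 + s) i j ω)
    (e := fun s i => stateError G α Q (k₀ + 1 + s) i j ω) (C := Δ)
    (fun t => (pi_norm_le_iff_of_nonneg hΔ.le).2 fun i => hbω _ i j)
    (fun t => state_succ G α Q (k₀ + 1 + t) j ω) (fun i => hω i j) i

theorem measurable_runningAverage {n : ℕ} (G : WeightedDigraph n) (α : ℝ) {Ω : Type*}
    [MeasurableSpace Ω] {μ : Measure Ω} {Q : ℕ → Fin n → Fin n → ℝ → Ω → ℝ}
    (hind : ErrorsIndependent μ Q) (k₀ K : ℕ) (i j : Fin n) :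
    Measurable (runningAverage G α Q k₀ K i j) := by
  obtain ⟨𝓖, hle, -, hQm⟩ := hind
  exact (Finset.measurable_sum _ fun k _ =>
    (measurable_state hQm k i j).mono (sourcesBefore_le hle k) le_rfl).const_mul _

/-- The first time after which an almost surely eventual property holds is measurable. -/
theorem exists_measurable_time {Ω : Type*} [MeasurableSpace Ω] {μ : Measure Ω}
    {p : ℕ → Ω → Prop} (hp : ∀ t, MeasurableSet {ω | p t ω})
    (h : ∀ᵐ ω ∂μ, ∀ᶠ t in atTop, p t ω) :
    ∃ τ : Ω → ℕ, Measurable τ ∧ ∀ᵐ ω ∂μ, ∀ t, τ ω ≤ t → p t ω := by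
  classical
  have hm : ∀ N, MeasurableSet {ω | ∀ t, N ≤ t → p t ω} := fun N => by
    simp_rw [Set.ofPred_forall]
    exact MeasurableSet.iInter fun t => MeasurableSet.iInter fun _ => hp t
  have hm' : MeasurableSet {ω | ¬ ∃ M, ∀ t, M ≤ t → p t ω} := by
    refine MeasurableSet.compl (s := {ω | ∃ M, ∀ t, M ≤ t → p t ω}) ?_
    rw [Set.ofPred_exists]
    exact MeasurableSet.iUnion hm
  -- The second alternative assigns time `0` where the property is not eventual, making the search
  -- total; this set is null.
  let q : Ω → ℕ → Prop := fun ω N => (∀ t, N ≤ t → p t ω) ∨ ¬ ∃ M, ∀ t, M ≤ t → p t ω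
  have hq : ∀ ω, ∃ N, q ω N := fun ω => by
    by_cases hω : ∃ M, ∀ t, M ≤ t → p t ω
    · exact hω.imp fun _ => Or.inl
    · exact ⟨0, Or.inr hω⟩
  refine ⟨fun ω => Nat.find (hq ω), measurable_find hq fun N => (hm N).union hm', ?_⟩
  filter_upwards [h] with ω hω
  exact (Nat.find_spec (hq ω)).resolve_right (not_not.2 (eventually_atTop.1 hω))

end QuantizedConsensus

theorem theorem3 {n : ℕ} (hn : 0 < n)
    (G : QuantizedConsensus.WeightedDigraph n) (hG : G.StronglyConnected)
    (w : Fin n → ℝ) (hw : Matrix.vecMul w G.laplacian = 0) (hw1 : ∑ i, w i = 1)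
    (α : ℝ) (hα : 0 < α) (hαd : ∀ i, α * G.inDegree i < 1)
    (Δ : ℝ) (hΔ : 0 < Δ)
    {Ω : Type*} [MeasurableSpace Ω] (μ : Measure Ω) [IsProbabilityMeasure μ]
    (Q : ℕ → Fin n → Fin n → ℝ → Ω → ℝ)
    (hQ : ∀ t i j, QuantizedConsensus.IsProbabilisticQuantizer μ Δ (Q t i j) ∨
      QuantizedConsensus.IsDitheredQuantizer μ Δ (Q t i j))
    (hind : QuantizedConsensus.ErrorsIndependent μ Q)
    (k₀ : ℕ) :
    (∀ i, 0 < w i) ∧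
    ∀ η : ℝ, 0 < η → η < 1 →
      ∃ tη : Ω → ℕ, Measurable tη ∧
        ∀ᵐ ω ∂μ, ∀ t : ℕ, tη ω ≤ t →
          η ≤ (⨅ i, QuantizedConsensus.runningAverage G α Q k₀ t i i ω / w i) ∧
          ∀ i, 0 < QuantizedConsensus.runningAverage G α Q k₀ t i i ω := by
  have hw0 : ∀ i, 0 < w i := by
    obtain ⟨N, hN⟩ :=
      QuantizedConsensus.WeightedDigraph.exists_consensusMatrix_pow_pos hG hα hαd
    exact QuantizedConsensus.pos_of_vecMul_eq hN
      (QuantizedConsensus.pow_mulVec_one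
        QuantizedConsensus.WeightedDigraph.consensusMatrix_mulVec_one N)
      (QuantizedConsensus.vecMul_pow
        (QuantizedConsensus.WeightedDigraph.vecMul_consensusMatrix hw) N) hw1
  refine ⟨hw0, fun η hη hη1 => ?_⟩
  obtain ⟨τ, hτ, h⟩ := QuantizedConsensus.exists_measurable_time (μ := μ)
    (p := fun t ω => ∀ i, η ≤ QuantizedConsensus.runningAverage G α Q k₀ t i i ω / w i)
    (fun t => by
      rw [Set.ofPred_forall]
      exact MeasurableSet.iInter fun i => measurableSet_le measurable_const
        ((QuantizedConsensus.measurable_runningAverage G α hind k₀ t i i).div_const _))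
    (by
      filter_upwards [QuantizedConsensus.ae_tendsto_runningAverage hG hw hw1 hα hαd hΔ hQ hind k₀]
        with ω hω
      refine Filter.eventually_all.2 fun i => ?_
      have hlim := (hω i i).div_const (w i)
      rw [div_self (hw0 i).ne'] at hlim
      exact hlim.eventually_const_le hη1)
  -- The empty average at `t = 0` is `0`, as `1 / 0 = 0`, so the bound by `η > 0` forces `τ ≥ 1`
  -- almost surely.
  refine ⟨τ, hτ, ?_⟩
  filter_upwards [h] with ω hω t ht
  have : Nonempty (Fin n) := ⟨⟨0, hn⟩⟩
  exact ⟨le_ciInf (hω t ht), fun i =>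
    (div_pos_iff_of_pos_right (hw0 i)).1 (hη.trans_le (hω t ht i))⟩
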